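/- Let $\alpha=(\alpha_0,\alpha_1,\alpha_2)$ and $\beta=(\beta_0,\beta_1,\beta_2)$ be in $\mathbf C^3$, such that $\alpha$ is not a multiple of $\beta$ and $(\alpha_1,\beta_1)$, $(\alpha_2,\beta_2)$, $(\beta_1,\beta_2)$ are all different from $(0,0)$. Let $f=f_{\alpha,\beta}$ be the rational self-map $$f[x_0:x_1:x_2]=[x_0\,(\beta\cdot x):x_2\,(\beta\cdot x):x_0\,(\alpha\cdot x)]$$ of $\mathbf P^2$ over $\mathbf C$, where $\alpha\cdot x=\alpha_0x_0+\alpha_1x_1+\alpha_2x_2$ and similarly for $\beta$. Let $\Sigma_0=\{x_0=0\}$, $\Sigma_\beta=\{\beta\cdot x=0\}$ and $\Sigma_\gamma=\{\gamma\cdot x=0\}$ with $\gamma=(\beta_1\alpha_0-\alpha_1\beta_0,\,0,\,\beta_1\alpha_2-\alpha_1\beta_2)$. The critical triangle $\{\Sigma_0,\Sigma_\beta,\Sigma_\gamma\}$ is called degenerate if these three lines are not pairwise distinct; this is the case if and only if $\beta_1=0$ or $\beta_1\alpha_2-\alpha_1\beta_2=0$. Let $\phi=(1+\sqrt5)/2$,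 let $\pi:Y\to\mathbf P^2$ be the blow-up at $e_1=[0:1:0]$ with exceptional fibre $E_1$, let $L_Y\in H^{1,1}(Y;\mathbf Z)$ be the pullback by $\pi$ of the class of a line, and for a rational map $g$ of $\mathbf P^2$ let $g_Y=\pi^{-1}\circ g\circ\pi$ be its lift to $Y$. For a dominant rational self-map $g_Y$ of $Y$, the map $g_Y^*$ on $H^{1,1}(Y;\mathbf Z)$ sends the class of a curve $D$ to the class of the divisor $g_Y^{-1}D$. If the critical triangle is degenerate, then: 1. the limit $\delta(\alpha,\beta)=\lim_{k\to\infty}(\operatorname{degree} f^k)^{1/k}$ exists and equals $\phi$, where $\operatorname{degree} f^k$ is the common degree of homogeneous polynomials without common factor that define the $k$-th iterate $f^k$; 2. $f_Y$ is 1-regular, that is, $(f_Y^n)^*=(f_Y^*)^n$ on $H^{1,1}(Y;\mathbf Z)$ for all $n\ge0$; 3. in the basis $(L_Y,E_1)$ of $H^{1,1}(Y;\mathbf Z)$, the matrix of $f_Y^*$ is $\begin{pmatrix}2&1\\-1&-1\end{pmatrix}$, and the spectral radius of this matrix is $\phi$. -/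

import Mathlib

open MvPolynomial

noncomputable section

namespace LinFracRec

/-! ### Rational self-maps of the projective plane and their degree growth -/

/-- A triple of polynomials in the homogeneous coordinates `x₀, x₁, x₂`; when the entries are
homogeneous of one degree and not all zero, it defines the rational map
`[x₀ : x₁ : x₂] ↦ [F₀ : F₁ : F₂]` of the complex projective plane. -/
abbrev PlaneMap : Type := Fin 3 → MvPolynomial (Fin 3) ℂ

/-- The linear form `c · x = c₀ x₀ + c₁ x₁ + c₂ x₂`. -/
def linForm (c : Fin 3 → ℂ) : MvPolynomial (Fin 3) ℂ := ∑ i, C (c i) * X i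

/-- The map `f_{α,β}[x₀ : x₁ : x₂] = [x₀ (β·x) : x₂ (β·x) : x₀ (α·x)]`, which on the affine chart
`x₀ = 1` is `(x₁, x₂) ↦ (x₂, (α₀ + α₁ x₁ + α₂ x₂) / (β₀ + β₁ x₁ + β₂ x₂))`. -/
def recMap (α β : Fin 3 → ℂ) : PlaneMap :=
  ![X 0 * linForm β, X 2 * linForm β, X 0 * linForm α]

/-- Homogeneous (not necessarily reduced) coordinates of the `k`-fold composition `F ∘ ⋯ ∘ F`. -/
def iter (F : PlaneMap) : ℕ → PlaneMap
  | 0 => fun i => X i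
  | k + 1 => fun i => bind₁ (iter F k) (F i)

/-- The rational map defined by `F` has degree `d`: it is also defined by a triple `G` of
homogeneous polynomials of degree `d` without a common factor. -/
def HasDegree (F : PlaneMap) (d : ℕ) : Prop :=
  F ≠ 0 ∧ ∃ G : PlaneMap, (∀ i, (G i).IsHomogeneous d) ∧
    (∀ q, (∀ i, q ∣ G i) → IsUnit q) ∧ ∀ i j, F i * G j = F j * G i

/-- The limit of `(degree F^k)^(1/k)` as `k → ∞` exists and equals `δ`. -/
def HasDynamicalDegree (F : PlaneMap) (δ : ℝ) : Prop :=
  ∃ d : ℕ → ℕ, (∀ k, HasDegree (iter F k) (d k)) ∧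
    Filter.Tendsto (fun k : ℕ => (d k : ℝ) ^ ((1 : ℝ) / (k : ℝ))) Filter.atTop (nhds δ)

/-! ### The critical triangle -/

/-- The curve `{c · x = 0}` in the projective plane. -/
def line (c : Fin 3 → ℂ) : Set (Projectivization ℂ (Fin 3 → ℂ)) := {x | c ⬝ᵥ x.rep = 0}

/-- The coefficients of the third factor of the Jacobian of `f_{α,β}`. -/
def gam (α β : Fin 3 → ℂ) : Fin 3 → ℂ :=
  ![β 1 * α 0 - α 1 * β 0, 0, β 1 * α 2 - α 1 * β 2]

/-- The critical triangle consists of the curves `Σ₀ = {x₀ = 0}`, `Σ_β = {β·x = 0}` and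
`Σ_γ = {γ·x = 0}`; it is degenerate when these are not three distinct curves. -/
def CriticalTriangleDegenerate (α β : Fin 3 → ℂ) : Prop :=
  ¬ (line ![1, 0, 0] ≠ line β ∧ line ![1, 0, 0] ≠ line (gam α β) ∧ line β ≠ line (gam α β))

/-! ### The blow-up `Y` of the plane at `e₁ = [0 : 1 : 0]`

`Y` is the surface `{(x, ξ) : x₀ ξ₂ = x₂ ξ₀}` in `ℙ² × ℙ¹`, used here through its homogeneous
(Cox) coordinates `(u, v, w, t)`, numbered `0, 1, 2, 3`.  The points of `Y` are the quadruples with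
`(u, v) ≠ (0, 0)` and `(w, t) ≠ (0, 0)`, up to
`(u, v, w, t) ∼ (λ μ⁻¹ u, λ μ⁻¹ v, λ w, μ t)` with `λ, μ ≠ 0`, and the quadruple `(u, v, w, t)`
is the point `([u t : w : v t], [u : v])`.  The exceptional fibre `E₁` is `{t = 0}`.

The curves (effective divisors) on `Y` are the zero divisors of the nonzero polynomials `h` that
are homogeneous for the corresponding grading by `ℤ²`, and two of them are linearly equivalent
exactly when the quotient of their equations is a rational function on `Y`, that is, when the
equations have the same bidegree.  So the bidegree is the class of the divisor in
`Pic Y = H^{1,1}(Y; ℤ)`, written in the basis `L_Y = π^* [line]`, `E₁`: the class of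
`π^*{x₁ = 0} = {w = 0}` is `L_Y`, that of `E₁ = {t = 0}` is `E₁`, and that of the strict
transforms `{u = 0}`, `{v = 0}` of the lines `{x₀ = 0}`, `{x₂ = 0}` through `e₁` is `L_Y - E₁`. -/

/-- Bidegrees of the coordinates `u, v, w, t` with respect to the basis `(L_Y, E₁)`. -/
def wt : Fin 4 → (Fin 2 → ℤ) := ![![1, -1], ![1, -1], ![1, 0], ![0, 1]]

/-- `h` defines a divisor of class `c` on `Y`. -/
def IsDivisorOfClass (h : MvPolynomial (Fin 4) ℂ) (c : Fin 2 → ℤ) : Prop :=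
  h ≠ 0 ∧ IsWeightedHomogeneous wt h c

/-- The blow-down `π : Y → ℙ²`, `(u, v, w, t) ↦ [u t : w : v t]`. -/
def blowDown : Fin 3 → MvPolynomial (Fin 4) ℂ := ![X 0 * X 3, X 2, X 1 * X 3]

/-- The coordinates `(u, v, w, t)` do parametrize the incidence surface
`{(x, ξ) : x₀ ξ₂ = x₂ ξ₀}`, with `π` the projection to `x`. -/
theorem exists_cox_point (x : Fin 3 → ℂ) (ξ : Fin 2 → ℂ) (hx : x ≠ 0) (hξ : ξ ≠ 0)
    (h : x 0 * ξ 1 = x 2 * ξ 0) :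
    ∃ z : Fin 4 → ℂ, (z 0 = ξ 0 ∧ z 1 = ξ 1) ∧ (z 2 ≠ 0 ∨ z 3 ≠ 0) ∧
      ∀ i, eval z (blowDown i) = x i := by
  have key : ∃ t : ℂ, x 0 = ξ 0 * t ∧ x 2 = ξ 1 * t := by
    by_cases h0 : ξ 0 = 0
    · have h1 : ξ 1 ≠ 0 := by
        intro h1
        apply hξ
        funext i
        fin_cases i <;> simp [h0, h1]
      refine ⟨x 2 / ξ 1, ?_, ?_⟩
      · have : x 0 = 0 := by simpa [h0, h1] using h
        simp [this, h0]
      · field_simp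
    · refine ⟨x 0 / ξ 0, ?_, ?_⟩
      · field_simp
      · field_simp
        linear_combination -h
  obtain ⟨t, h0, h2⟩ := key
  refine ⟨![ξ 0, ξ 1, x 1, t], by simp, ?_, ?_⟩
  · by_contra hc
    push Not at hc
    obtain ⟨hw, ht⟩ := hc
    simp only [Matrix.cons_val] at hw ht
    apply hx
    funext i
    fin_cases i <;> simp [h0, h2, hw, ht]
  · intro i
    fin_cases i <;> simp [blowDown, h0, h2]

/-- `Φ` is a rational self-map of `Y` in homogeneous coordinates: its entries are bihomogeneous,
of bidegrees that are compatible with those of `u, v, w, t`, and neither the first two nor the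
last two have a common factor, so that `Φ` is undefined at finitely many points of `Y` only. -/
def IsSelfMapOfY (Φ : Fin 4 → MvPolynomial (Fin 4) ℂ) : Prop :=
  (∃ T : Matrix (Fin 2) (Fin 2) ℤ, ∀ j, IsWeightedHomogeneous wt (Φ j) (T.mulVec (wt j))) ∧
    IsRelPrime (Φ 0) (Φ 1) ∧ IsRelPrime (Φ 2) (Φ 3)

/-- `Φ` is the lift `F_Y = π⁻¹ ∘ F ∘ π` to `Y` of the rational map `F` of the plane:
`π ∘ Φ = F ∘ π` as rational maps from `Y` to the plane.  (For dominant `F` such a `Φ` is unique up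
to the identification of coordinates of the same point.) -/
def IsLiftToY (F : PlaneMap) (Φ : Fin 4 → MvPolynomial (Fin 4) ℂ) : Prop :=
  F ≠ 0 ∧ IsSelfMapOfY Φ ∧
    ∀ i j, bind₁ blowDown (F i) * bind₁ Φ (blowDown j)
      = bind₁ blowDown (F j) * bind₁ Φ (blowDown i)

/-- `T` is the matrix, in the basis `(L_Y, E₁)`, of the pullback `F_Y^*` on `H^{1,1}(Y; ℤ)`: for
every curve `D = {h = 0}` on `Y`, the divisor `F_Y⁻¹ D = {h ∘ F_Y = 0}` has class `T [D]`. -/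
def HasPullbackMatrix (F : PlaneMap) (T : Matrix (Fin 2) (Fin 2) ℤ) : Prop :=
  ∃ Φ, IsLiftToY F Φ ∧
    ∀ h c, IsDivisorOfClass h c → IsDivisorOfClass (bind₁ Φ h) (T.mulVec c)

/-- The lift `F_Y` is 1-regular: `(F_Y^n)^* = (F_Y^*)^n` for all `n ≥ 0`.  (The rational map
`F_Y^n` is the lift of `F^n`.) -/
def LiftIsOneRegular (F : PlaneMap) : Prop :=
  ∃ T, HasPullbackMatrix F T ∧ ∀ n : ℕ, HasPullbackMatrix (iter F n) (T ^ n)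

end LinFracRec

end

open MvPolynomial

noncomputable section

namespace LinFracRec

/-! ### Common factors -/

/-! Let `a`, `b` be the pullbacks of `α·x`, `β·x` to the coordinates `(u, v, w, t)` of `Y`. The lift
of `f` is `Φ = (b, a, v b, u)`, since `f ∘ π = t · (π ∘ Φ)`, and its bidegrees give the matrix `T`.
The entries of the composite `Φ^n` have the bidegrees prescribed by `T^n`; the one possible
obstruction to `(f_Y^n)^* = T^n` is a common factor of the first two or of the last two entries. So
everything reduces to `IteratesReduced`. Granting it, setting `t = 1` in `π ∘ Φ^n` gives reduced
coordinates of `f^n`, of degree the `L_Y`-coordinate of `T^n L_Y`. This is the Fibonacci number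
`F_{n+2}`, and its `n`-th root tends to `φ`.

Degeneracy enters only in `IteratesReduced`. If `γ₂ = 0 ≠ β₁`, then `f_Y` has the single
indeterminacy point `u = b = 0`, and induction shows that no iterate maps a curve to it. If `β₁ =
0`, then `b = t l` with `l` linear in `u, v`, and `Φ` is invertible off `t l = 0`, so a new common
factor divides `t` or `l`. Both of these curves are contracted to `[0 : 0 : 1]`, whose orbit
alternates between that point and a point of `E₁`, and so never produces a common factor. -/

theorem dvd_of_dvd_mul_of_isRelPrime {A : Type*} [CommRing A] [IsDomain A]
    [UniqueFactorizationMonoid A] {s x m n : A} (h : IsRelPrime m n)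
    (hm : s ∣ x * m) (hn : s ∣ x * n) : s ∣ x := by
  let := UniqueFactorizationMonoid.toGCDMonoid A
  have h1 : s ∣ gcd (x * m) (x * n) := dvd_gcd hm hn
  have h2 : s ∣ x * gcd m n := h1.trans (gcd_mul_left' x m n).dvd
  have h3 : IsUnit (gcd m n) := h (gcd_dvd_left m n) (gcd_dvd_right m n)
  exact (h3.dvd_mul_right).1 h2

theorem isRelPrime_of_no_prime_factors {A : Type*} [CommRing A] [IsDomain A]
    [UniqueFactorizationMonoid A] {x y : A} (nonzero : ¬ (x = 0 ∧ y = 0))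
    (H : ∀ q, Prime q → q ∣ x → ¬ q ∣ y) : IsRelPrime x y :=
  WfDvdMonoid.isRelPrime_of_no_irreducible_factors nonzero fun q hq =>
    H q (UniqueFactorizationMonoid.irreducible_iff_prime.1 hq)

/-- If an injective endomorphism `φ` becomes surjective after inverting `φ K`, then images of
coprime elements can only have prime factors of `φ K` in common. -/
theorem prime_dvd_of_dvd_map_of_dvd_map {A : Type*} [CommRing A] [IsDomain A]
    [UniqueFactorizationMonoid A] (φ : A →+* A) (hφ : Function.Injective φ) (K : A)
    (hK : ∀ r, ∃ (N : ℕ) (s : A), φ K ^ N * r = φ s) {m n q : A} (hmn : IsRelPrime m n)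
    (hq : Prime q) (hm : q ∣ φ m) (hn : q ∣ φ n) : q ∣ φ K := by
  obtain ⟨r₁, h₁⟩ := hm
  obtain ⟨r₂, h₂⟩ := hn
  obtain ⟨N, s, hs⟩ := hK q
  obtain ⟨N₁, s₁, hs₁⟩ := hK r₁
  obtain ⟨N₂, s₂, hs₂⟩ := hK r₂
  -- Clearing denominators moves both factorizations `φ m = q r₁`, `φ n = q r₂` back to the source,
  -- with `s` in the role of `q`. The surplus powers of `K` make the two exponents equal.
  have d₁ : s ∣ K ^ (N + N₁ + N₂) * m := by
    refine ⟨s₁ * K ^ N₂, hφ ?_⟩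
    simp only [map_mul, map_pow, ← hs, ← hs₁, h₁]
    ring
  have d₂ : s ∣ K ^ (N + N₁ + N₂) * n := by
    refine ⟨s₂ * K ^ N₁, hφ ?_⟩
    simp only [map_mul, map_pow, ← hs, ← hs₂, h₂]
    ring
  have d := map_dvd φ (dvd_of_dvd_mul_of_isRelPrime hmn d₁ d₂)
  rw [← hs, map_pow] at d
  exact hq.dvd_of_dvd_pow ((Dvd.intro_left _ rfl).trans d)

theorem exists_pow_mul_mem_range {σ : Type*}
    (φ : MvPolynomial σ ℂ →ₐ[ℂ] MvPolynomial σ ℂ) (K : MvPolynomial σ ℂ)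
    (hX : ∀ i, ∃ (N : ℕ) (s : MvPolynomial σ ℂ), φ K ^ N * X i = φ s) (r : MvPolynomial σ ℂ) :
    ∃ (N : ℕ) (s : MvPolynomial σ ℂ), φ K ^ N * r = φ s := by
  induction r using MvPolynomial.induction_on with
  | C a => exact ⟨0, C a, by simp [← algebraMap_eq]⟩
  | add p q hp hq =>
    obtain ⟨N, s, h⟩ := hp
    obtain ⟨M, t, h'⟩ := hq
    refine ⟨N + M, K ^ M * s + K ^ N * t, ?_⟩
    simp only [map_add, map_mul, map_pow, ← h, ← h']
    ring
  | mul_X p i hp =>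
    obtain ⟨N, s, h⟩ := hp
    obtain ⟨M, t, h'⟩ := hX i
    refine ⟨N + M, s * t, ?_⟩
    simp only [map_mul, ← h, ← h']
    ring

/-! ### Bihomogeneous polynomials -/

theorem isWeightedHomogeneous_bind₁ {Φ : Fin 4 → MvPolynomial (Fin 4) ℂ}
    {T : Matrix (Fin 2) (Fin 2) ℤ}
    (hΦ : ∀ j, IsWeightedHomogeneous wt (Φ j) (T.mulVec (wt j))) {h : MvPolynomial (Fin 4) ℂ}
    {c : Fin 2 → ℤ} (hh : IsWeightedHomogeneous wt h c) :
    IsWeightedHomogeneous wt (bind₁ Φ h) (T.mulVec c) := by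
  rw [h.as_sum, map_sum]
  refine IsWeightedHomogeneous.sum _ _ _ fun d hd => ?_
  rw [bind₁_monomial]
  refine IsWeightedHomogeneous.C_mul ?_ _
  have hc := hh (mem_support_iff.1 hd)
  have := IsWeightedHomogeneous.prod d.support (fun i => Φ i ^ d i)
    (fun i => d i • T.mulVec (wt i)) (fun i _ => (hΦ i).pow (d i))
  convert this using 1
  rw [← hc, Finsupp.weight_apply, Finsupp.sum, Matrix.mulVec_sum]
  exact Finset.sum_congr rfl fun i _ => Matrix.mulVec_smul _ _ _

/-- Restriction to the chart `t = 1`, in the coordinates of the plane. -/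
def chart : Fin 4 → MvPolynomial (Fin 3) ℂ := ![X 0, X 2, X 1, 1]

theorem bind₁_chart_bind₁_blowDown (p : MvPolynomial (Fin 3) ℂ) :
    bind₁ chart (bind₁ blowDown p) = p := by
  rw [bind₁_bind₁]
  conv_rhs => rw [← aeval_X_left_apply p]
  rw [bind₁]
  congr 2
  funext i
  fin_cases i <;> simp [chart, blowDown]

theorem weight_wt (d : Fin 4 →₀ ℕ) :
    Finsupp.weight wt d = ![(d 0 : ℤ) + d 1 + d 2, (d 3 : ℤ) - d 0 - d 1] := by
  rw [Finsupp.weight_apply, Finsupp.sum_fintype _ _ (by simp)]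
  funext i
  fin_cases i <;> simp [Fin.sum_univ_four, wt]
  ring

/-- The `L_Y`-coordinate of a bidegree counts `u`, `v`, `w` once each and ignores `t`. -/
theorem isHomogeneous_bind₁_chart {h : MvPolynomial (Fin 4) ℂ} {c : Fin 2 → ℤ} {n : ℕ}
    (hh : IsWeightedHomogeneous wt h c) (hc : c 0 = n) : (bind₁ chart h).IsHomogeneous n := by
  rw [h.as_sum, map_sum]
  refine IsHomogeneous.sum _ _ _ fun d hd => ?_
  have hw := congrFun ((weight_wt d).symm.trans (hh (mem_support_iff.1 hd))) 0
  have hn : n = d 0 + d 1 + d 2 := by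
    rw [hc] at hw
    simp only [Matrix.cons_val_zero] at hw
    omega
  rw [bind₁_monomial, ← zero_add n, hn]
  refine (isHomogeneous_C _ _).mul ?_
  rw [Finset.prod_subset (Finset.subset_univ _) (by simp +contextual)]
  simp only [Fin.prod_univ_four, chart]
  simpa using (((isHomogeneous_X ℂ (0 : Fin 3)).pow (d 0)).mul
    ((isHomogeneous_X ℂ (2 : Fin 3)).pow (d 1))).mul ((isHomogeneous_X ℂ (1 : Fin 3)).pow (d 2))

/-- A bihomogeneous polynomial is recovered from its restriction to `t = 1`, up to powers
of `t`. -/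
theorem pow_mul_bind₁_blowDown_bind₁_chart {h : MvPolynomial (Fin 4) ℂ} {c : Fin 2 → ℤ}
    (hh : IsWeightedHomogeneous wt h c) :
    X 3 ^ (c 1).toNat * bind₁ blowDown (bind₁ chart h) = X 3 ^ (-c 1).toNat * h := by
  conv_lhs => rw [h.as_sum]
  conv_rhs => rw [h.as_sum]
  simp only [map_sum, Finset.mul_sum]
  refine Finset.sum_congr rfl fun d hd => ?_
  have hw := congrFun ((weight_wt d).symm.trans (hh (mem_support_iff.1 hd))) 1
  -- The `E₁`-coordinate is `c 1 = d 3 - d 0 - d 1`. It can have either sign, so it is split into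
  -- positive and negative parts.
  have e : (c 1).toNat + d 0 + d 1 = (-c 1).toNat + d 3 := by
    simp only [Matrix.cons_val_one, Matrix.cons_val_fin_one] at hw
    omega
  rw [bind₁_monomial, monomial_eq, map_mul, Finsupp.prod_fintype _ _ (by simp),
    Finset.prod_subset (Finset.subset_univ _) (by simp +contextual)]
  simp only [Fin.prod_univ_four, chart, map_mul, map_pow, algHom_C, algebraMap_eq]
  simp only [Matrix.cons_val, bind₁_X_right, blowDown, map_one, one_pow]
  have e' := congrArg (fun k => (X 3 : MvPolynomial (Fin 4) ℂ) ^ k) e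
  simp only [pow_add] at e'
  linear_combination (C (coeff d h) * X 0 ^ d 0 * X 1 ^ d 1 * X 2 ^ d 2) * e'

theorem isRelPrime_bind₁_chart {p q : MvPolynomial (Fin 4) ℂ} {c c' : Fin 2 → ℤ}
    (hp : IsWeightedHomogeneous wt p c) (hq : IsWeightedHomogeneous wt q c')
    (h : IsRelPrime p q) : IsRelPrime (bind₁ chart p) (bind₁ chart q) := by
  intro g hgp hgq
  have key : ∀ {r : MvPolynomial (Fin 4) ℂ} {e : Fin 2 → ℤ}, IsWeightedHomogeneous wt r e →
      g ∣ bind₁ chart r → ∀ N, bind₁ blowDown g ∣ X 3 ^ ((-e 1).toNat + N) * r := by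
    intro r e hr hg N
    have h1 := (map_dvd (bind₁ blowDown) hg).mul_left (X 3 ^ N * X 3 ^ (e 1).toNat)
    rw [mul_assoc, pow_mul_bind₁_blowDown_bind₁_chart hr] at h1
    convert h1 using 1
    ring
  -- The pullback of `g` divides one and the same power of `t` times both `p` and `q`, hence that
  -- power itself, which becomes `1` on the chart.
  have h1 := key hp hgp (-c' 1).toNat
  have h2 := key hq hgq (-c 1).toNat
  rw [add_comm] at h2
  have h3 := map_dvd (bind₁ chart) (dvd_of_dvd_mul_of_isRelPrime h h1 h2)
  rw [bind₁_chart_bind₁_blowDown] at h3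
  refine isUnit_of_dvd_one (h3.trans ?_)
  simp [chart]


/-! ### The golden ratio -/

theorem goldenRatio_pow_le_fib (n : ℕ) : Real.goldenRatio ^ n ≤ (Nat.fib (n + 2) : ℝ) := by
  induction n using Nat.twoStepInduction with
  | zero => simp
  | one => simpa [Nat.fib] using Real.goldenRatio_lt_two.le
  | more n h1 h2 =>
    rw [Nat.fib_add_two (n := n + 2)]
    push_cast
    linarith [Real.goldenRatio_pow_sub_goldenRatio_pow n]

theorem fib_le_goldenRatio_pow (n : ℕ) : (Nat.fib (n + 2) : ℝ) ≤ Real.goldenRatio ^ (n + 1) := by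
  induction n using Nat.twoStepInduction with
  | zero => simpa using Real.one_lt_goldenRatio.le
  | one =>
    have := Real.goldenRatio_sq
    have := Real.one_lt_goldenRatio
    norm_num [Nat.fib]
    linarith
  | more n h1 h2 =>
    rw [Nat.fib_add_two (n := n + 2)]
    push_cast
    linarith [Real.goldenRatio_pow_sub_goldenRatio_pow (n + 1)]

theorem tendsto_fib_rpow :
    Filter.Tendsto (fun k : ℕ => (Nat.fib (k + 2) : ℝ) ^ ((1 : ℝ) / (k : ℝ))) Filter.atTop
      (nhds Real.goldenRatio) := by
  have hφ := Real.goldenRatio_pos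
  have h1 : Filter.Tendsto (fun k : ℕ => Real.goldenRatio * Real.goldenRatio ^ ((1 : ℝ) / (k : ℝ)))
      Filter.atTop (nhds (Real.goldenRatio * Real.goldenRatio ^ (0 : ℝ))) :=
    (tendsto_const_nhds.rpow tendsto_one_div_atTop_nhds_zero_nat (Or.inl hφ.ne')).const_mul _
  rw [Real.rpow_zero, mul_one] at h1
  refine tendsto_of_tendsto_of_tendsto_of_le_of_le' tendsto_const_nhds h1 ?_ ?_
  · filter_upwards [Filter.eventually_gt_atTop 0] with k hk
    calc Real.goldenRatio = (Real.goldenRatio ^ k) ^ ((1 : ℝ) / (k : ℝ)) := by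
          rw [one_div, Real.pow_rpow_inv_natCast hφ.le hk.ne']
      _ ≤ _ := Real.rpow_le_rpow (by positivity) (goldenRatio_pow_le_fib k) (by positivity)
  · filter_upwards [Filter.eventually_gt_atTop 0] with k hk
    calc (Nat.fib (k + 2) : ℝ) ^ ((1 : ℝ) / (k : ℝ))
        ≤ (Real.goldenRatio ^ (k + 1)) ^ ((1 : ℝ) / (k : ℝ)) :=
          Real.rpow_le_rpow (by positivity) (fib_le_goldenRatio_pow k) (by positivity)
      _ = _ := by
          rw [pow_succ, Real.mul_rpow (by positivity) hφ.le, one_div,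
            Real.pow_rpow_inv_natCast hφ.le hk.ne']

theorem spectrum_pullbackMatrix :
    spectrum ℂ ((!![2, 1; -1, -1] : Matrix (Fin 2) (Fin 2) ℤ).map (Int.cast : ℤ → ℂ))
      = {(Real.goldenRatio : ℂ), (Real.goldenConj : ℂ)} := by
  ext z
  have hs : (Real.goldenRatio : ℂ) + (Real.goldenConj : ℂ) = 1 := by
    exact_mod_cast Real.goldenRatio_add_goldenConj
  have hp : (Real.goldenRatio : ℂ) * (Real.goldenConj : ℂ) = -1 := by
    exact_mod_cast Real.goldenRatio_mul_goldenConj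
  generalize (Real.goldenRatio : ℂ) = a at *
  generalize (Real.goldenConj : ℂ) = b at *
  rw [Matrix.mem_spectrum_iff_isRoot_charpoly, Polynomial.IsRoot, Matrix.eval_charpoly,
    Matrix.det_fin_two]
  simp only [Matrix.sub_apply, Matrix.scalar_apply, Matrix.diagonal_apply, Matrix.map_apply,
    Set.mem_insert_iff, Set.mem_singleton_iff]
  rw [← sub_eq_zero (a := z), ← sub_eq_zero (a := z) (b := b), ← mul_eq_zero]
  -- Both sides equal `z² - z - 1`: the matrix has trace `1` and determinant `-1`.
  have e : (z - a) * (z - b) = (z - 2) * (z + 1) + 1 := by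
    linear_combination hp - z * hs
  rw [e]
  simp

theorem spectralRadius_pullbackMatrix :
    spectralRadius ℂ ((!![2, 1; -1, -1] : Matrix (Fin 2) (Fin 2) ℤ).map (Int.cast : ℤ → ℂ))
      = ENNReal.ofReal Real.goldenRatio := by
  have h1 : (‖(Real.goldenRatio : ℂ)‖₊ : ENNReal) = ENNReal.ofReal Real.goldenRatio := by
    rw [← enorm_eq_nnnorm, ← ofReal_norm, Complex.norm_real, Real.norm_eq_abs,
      abs_of_pos Real.goldenRatio_pos]
  have h2 : (‖(Real.goldenConj : ℂ)‖₊ : ENNReal) ≤ ENNReal.ofReal Real.goldenRatio := by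
    rw [← enorm_eq_nnnorm, ← ofReal_norm, Complex.norm_real, Real.norm_eq_abs]
    refine ENNReal.ofReal_le_ofReal ?_
    rw [abs_of_neg Real.goldenConj_neg]
    linarith [Real.neg_one_lt_goldenConj, Real.one_lt_goldenRatio]
  rw [spectralRadius, spectrum_pullbackMatrix, iSup_insert, iSup_singleton, h1, sup_eq_left]
  exact h2

/-! ### The critical triangle -/

theorem mk_mem_line (c : Fin 3 → ℂ) {v : Fin 3 → ℂ} (hv : v ≠ 0) :
    Projectivization.mk ℂ v hv ∈ line c ↔ c ⬝ᵥ v = 0 := by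
  obtain ⟨a, ha⟩ := Projectivization.exists_smul_eq_mk_rep ℂ v hv
  rw [line, Set.mem_ofPred_eq, ← ha, Units.smul_def, dotProduct_smul, smul_eq_mul, mul_eq_zero]
  simp

theorem mul_eq_mul_of_line_eq {c d : Fin 3 → ℂ} (h : line c = line d) (i j : Fin 3) :
    c i * d j = c j * d i := by
  -- If nonzero, this vector is a point of `line c`, so also of `line d`; that is the claimed minor.
  by_cases hv : (Pi.single i (c j) - Pi.single j (c i) : Fin 3 → ℂ) = 0
  · rcases eq_or_ne i j with rfl | hij
    · rfl
    have h1 := congrFun hv i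
    have h2 := congrFun hv j
    simp [hij, hij.symm] at h1 h2
    simp [h1, h2]
  · have h1 := mk_mem_line c hv
    rw [h, mk_mem_line d hv] at h1
    simp only [dotProduct_sub, dotProduct_single] at h1
    linear_combination -(h1.2 (by ring))

theorem line_smul {a : ℂ} (ha : a ≠ 0) (c : Fin 3 → ℂ) : line (a • c) = line c := by
  ext x
  simp [line, ha]

/-- Makes `Σ_γ` a genuine line; it is also the condition used below for `f` to be dominant. -/
theorem gam_ne_zero {α β : Fin 3 → ℂ} (hαβ : ∀ c : ℂ, α ≠ c • β)
    (h₁ : (α 1, β 1) ≠ (0, 0)) (h₃ : (β 1, β 2) ≠ (0, 0)) :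
    β 1 * α 0 - α 1 * β 0 ≠ 0 ∨ β 1 * α 2 - α 1 * β 2 ≠ 0 := by
  by_contra hc
  push Not at hc
  obtain ⟨h0, h2⟩ := hc
  rcases eq_or_ne (β 1) 0 with hb | hb
  · simp_all
  · apply hαβ (α 1 / β 1)
    funext i
    fin_cases i <;> simp <;> field_simp
    · linear_combination h0
    · linear_combination h2

theorem criticalTriangleDegenerate_iff {α β : Fin 3 → ℂ} (hαβ : ∀ c : ℂ, α ≠ c • β)
    (h₁ : (α 1, β 1) ≠ (0, 0)) (h₃ : (β 1, β 2) ≠ (0, 0)) :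
    CriticalTriangleDegenerate α β ↔ β 1 = 0 ∨ β 1 * α 2 - α 1 * β 2 = 0 := by
  rw [CriticalTriangleDegenerate]
  constructor
  · intro h
    by_contra hc
    push Not at hc
    refine h ⟨fun e => ?_, fun e => ?_, fun e => ?_⟩
    · simpa [hc.1] using mul_eq_mul_of_line_eq e 0 1
    · simpa [gam, hc.2] using mul_eq_mul_of_line_eq e 0 2
    · simpa [gam, hc.1, hc.2] using mul_eq_mul_of_line_eq e 1 2
  · rintro (h | h) ⟨-, h02, h12⟩
    · have hα : α 1 ≠ 0 := by
        intro h'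
        exact h₁ (by simp [h, h'])
      apply h12
      -- For `β₁ = 0` one has `γ = -α₁ β`.
      rw [← line_smul (neg_ne_zero.2 hα) β]
      congr 1
      funext i
      fin_cases i <;> simp [gam, h]
    · have h0 := (gam_ne_zero hαβ h₁ h₃).resolve_right (by simp [h])
      apply h02
      rw [← line_smul h0]
      congr 1
      funext i
      fin_cases i <;> simp [gam, h]


/-! ### The lift of `f_{α,β}` and its iterates -/

/-- The pullback to `Y` of the linear form `c · x`. -/
def formY (c : Fin 3 → ℂ) : MvPolynomial (Fin 4) ℂ :=
  C (c 0) * (X 0 * X 3) + C (c 1) * X 2 + C (c 2) * (X 1 * X 3)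

theorem bind₁_blowDown_linForm (c : Fin 3 → ℂ) : bind₁ blowDown (linForm c) = formY c := by
  simp [linForm, Fin.sum_univ_three, blowDown, formY, algHom_C, algebraMap_eq]

theorem bind₁_formY (Ψ : Fin 4 → MvPolynomial (Fin 4) ℂ) (c : Fin 3 → ℂ) :
    bind₁ Ψ (formY c) = C (c 0) * (Ψ 0 * Ψ 3) + C (c 1) * Ψ 2 + C (c 2) * (Ψ 1 * Ψ 3) := by
  simp [formY, algHom_C, algebraMap_eq]

/-- The lift of `f_{α,β}` to `Y`. -/
def liftMap (α β : Fin 3 → ℂ) : Fin 4 → MvPolynomial (Fin 4) ℂ :=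
  ![formY β, formY α, X 1 * formY β, X 0]

/-- Compositions of a self-map of `Y` with itself. -/
def liftIter (Φ : Fin 4 → MvPolynomial (Fin 4) ℂ) : ℕ → Fin 4 → MvPolynomial (Fin 4) ℂ
  | 0 => X
  | n + 1 => fun j => bind₁ (liftIter Φ n) (Φ j)

theorem bind₁_liftIter_succ (Φ : Fin 4 → MvPolynomial (Fin 4) ℂ) (n : ℕ)
    (p : MvPolynomial (Fin 4) ℂ) :
    bind₁ (liftIter Φ (n + 1)) p = bind₁ (liftIter Φ n) (bind₁ Φ p) := by
  rw [bind₁_bind₁]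
  rfl

theorem liftIter_one (Φ : Fin 4 → MvPolynomial (Fin 4) ℂ) : liftIter Φ 1 = Φ := by
  funext j
  exact aeval_X_left_apply _

/-- The definition applies `Φ` last; here it is applied first, so that the entries of the next
iterate are images under one fixed endomorphism. -/
theorem liftIter_succ' (Φ : Fin 4 → MvPolynomial (Fin 4) ℂ) (n : ℕ) (j : Fin 4) :
    liftIter Φ (n + 1) j = bind₁ Φ (liftIter Φ n j) := by
  induction n generalizing j with
  | zero => simp [liftIter]
  | succ n ih =>
    calc bind₁ (liftIter Φ (n + 1)) (Φ j)
        = bind₁ (fun i => bind₁ Φ (liftIter Φ n i)) (Φ j) := by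
          rw [show liftIter Φ (n + 1) = fun i => bind₁ Φ (liftIter Φ n i) from funext ih]
      _ = bind₁ Φ (bind₁ (liftIter Φ n) (Φ j)) := (bind₁_bind₁ _ _ _).symm

theorem liftIter_liftMap_succ (α β : Fin 3 → ℂ) (n : ℕ) :
    liftIter (liftMap α β) (n + 1) =
      ![bind₁ (liftIter (liftMap α β) n) (formY β), bind₁ (liftIter (liftMap α β) n) (formY α),
        liftIter (liftMap α β) n 1 * bind₁ (liftIter (liftMap α β) n) (formY β),
        liftIter (liftMap α β) n 0] := by
  funext j
  rw [liftIter]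
  fin_cases j <;> simp [liftMap]

/-- The matrix of the pullback by the lift of `f_{α,β}`. -/
def pullbackMatrix : Matrix (Fin 2) (Fin 2) ℤ := !![2, 1; -1, -1]

theorem isWeightedHomogeneous_formY (c : Fin 3 → ℂ) :
    IsWeightedHomogeneous wt (formY c) ![1, 0] := by
  have hX := fun i => isWeightedHomogeneous_X ℂ wt i
  have h0 : wt 0 + wt 3 = ![1, 0] := by ext i; fin_cases i <;> simp [wt]
  have h1 : wt 1 + wt 3 = ![1, 0] := by ext i; fin_cases i <;> simp [wt]
  exact (((h0 ▸ (hX 0).mul (hX 3)).C_mul _).add ((hX 2).C_mul _)).add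
    ((h1 ▸ (hX 1).mul (hX 3)).C_mul _)

theorem isWeightedHomogeneous_liftMap (α β : Fin 3 → ℂ) (j : Fin 4) :
    IsWeightedHomogeneous wt (liftMap α β j) (pullbackMatrix.mulVec (wt j)) := by
  have hX := fun i => isWeightedHomogeneous_X ℂ wt i
  have e : ∀ j, pullbackMatrix.mulVec (wt j) =
      (![![1, 0], ![1, 0], ![2, -1], ![1, -1]] : Fin 4 → Fin 2 → ℤ) j := by
    intro j
    ext i
    fin_cases j <;> fin_cases i <;> simp [wt, pullbackMatrix]
  have h : wt 1 + ![1, 0] = ![2, -1] := by ext i; fin_cases i <;> simp [wt]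
  rw [e]
  fin_cases j
  · exact isWeightedHomogeneous_formY β
  · exact isWeightedHomogeneous_formY α
  · exact h ▸ (hX 1).mul (isWeightedHomogeneous_formY β)
  · exact hX 0

theorem isWeightedHomogeneous_liftIter (α β : Fin 3 → ℂ) (n : ℕ) (j : Fin 4) :
    IsWeightedHomogeneous wt (liftIter (liftMap α β) n j)
      ((pullbackMatrix ^ n).mulVec (wt j)) := by
  induction n generalizing j with
  | zero => simpa [liftIter] using isWeightedHomogeneous_X ℂ wt j
  | succ n ih =>
    rw [pow_succ, ← Matrix.mulVec_mulVec]
    exact isWeightedHomogeneous_bind₁ ih (isWeightedHomogeneous_liftMap α β j)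

theorem pullbackMatrix_pow_mulVec (n : ℕ) :
    (pullbackMatrix ^ n).mulVec ![1, 0] = ![(Nat.fib (n + 2) : ℤ), -(Nat.fib n : ℤ)] := by
  induction n with
  | zero => simp
  | succ n ih =>
    rw [pow_succ', ← Matrix.mulVec_mulVec, ih, Nat.fib_add_two (n := n + 1),
      Nat.fib_add_two (n := n)]
    ext i
    fin_cases i <;> simp [pullbackMatrix]
    ring

/-- Dominance: a generic `z` has an explicit preimage under `Φ`, so `h ∘ Φ = 0` forces `h z = 0`. -/
theorem liftMap_injective {α β : Fin 3 → ℂ}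
    (hγ : β 1 * α 0 - α 1 * β 0 ≠ 0 ∨ β 1 * α 2 - α 1 * β 2 ≠ 0) :
    Function.Injective (bind₁ (liftMap α β)) := by
  rw [injective_iff_map_eq_zero]
  intro h hh
  by_contra hne
  set D : MvPolynomial (Fin 4) ℂ := C (β 1 * α 0 - α 1 * β 0) * (X 0 * X 3)
    + C (β 1 * α 2 - α 1 * β 2) * X 2 with hD
  have hD0 : D ≠ 0 := by
    intro h0
    rcases hγ with hγ | hγ
    · have := congrArg (eval ![1, 0, 0, 1]) h0
      simp [hD] at this
      exact hγ this
    · have := congrArg (eval ![0, 0, 1, 0]) h0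
      simp [hD] at this
      exact hγ this
  have hprod : h * (X 0 * D) ≠ 0 := mul_ne_zero hne (mul_ne_zero (X_ne_zero _) hD0)
  obtain ⟨z, hz⟩ : ∃ z, eval z (h * (X 0 * D)) ≠ 0 := by
    by_contra hc
    push Not at hc
    exact hprod (MvPolynomial.funext fun z => by simp [hc z])
  simp only [map_mul, eval_X, mul_ne_zero_iff] at hz
  obtain ⟨hz, hz0, hzD⟩ := hz
  simp only [hD, map_add, map_mul, eval_C, eval_X] at hzD
  set δ := (β 1 * α 0 - α 1 * β 0) * (z 0 * z 3) + (β 1 * α 2 - α 1 * β 2) * z 2 with hδ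
  -- The last two coordinates of `z` force `u = z 3` and `v = z 2 / z 0`. Then `b = z 0`, `a = z 1`
  -- is a linear system in `t`, `w`, whose determinant is nonzero when `D` does not vanish at `z`.
  set A := α 0 * z 3 + α 2 * (z 2 / z 0) with hA
  set B := β 0 * z 3 + β 2 * (z 2 / z 0) with hB
  have hAB : β 1 * A - α 1 * B = δ / z 0 := by
    rw [hA, hB, hδ]
    field_simp
    ring
  have hAB0 : β 1 * A - α 1 * B ≠ 0 := by
    rw [hAB]
    exact div_ne_zero hzD hz0
  set t := (β 1 * z 1 - α 1 * z 0) / (β 1 * A - α 1 * B) with ht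
  set w := (A * z 0 - B * z 1) / (β 1 * A - α 1 * B) with hw
  have htm : t * (β 1 * A - α 1 * B) = β 1 * z 1 - α 1 * z 0 := div_mul_cancel₀ _ hAB0
  have hwm : w * (β 1 * A - α 1 * B) = A * z 0 - B * z 1 := div_mul_cancel₀ _ hAB0
  have e0 : B * t + β 1 * w = z 0 := by
    refine mul_right_cancel₀ hAB0 ?_
    linear_combination B * htm + β 1 * hwm
  have e1 : A * t + α 1 * w = z 1 := by
    refine mul_right_cancel₀ hAB0 ?_
    linear_combination A * htm + α 1 * hwm
  have hy : (fun j => eval ![z 3, z 2 / z 0, w, t] (liftMap α β j)) = z := by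
    have f0 : eval ![z 3, z 2 / z 0, w, t] (formY β) = z 0 := by
      simp [formY]
      linear_combination e0
    have f1 : eval ![z 3, z 2 / z 0, w, t] (formY α) = z 1 := by
      simp [formY]
      linear_combination e1
    funext j
    fin_cases j
    · exact f0
    · exact f1
    · simp [liftMap, f0]
      field_simp
    · simp [liftMap]
  apply hz
  have := congrArg (eval ![z 3, z 2 / z 0, w, t]) hh
  rw [← coe_aeval_eq_eval, RingHom.coe_coe, aeval_bind₁] at this
  rw [map_zero] at this
  rw [← coe_aeval_eq_eval, RingHom.coe_coe, ← this]
  congr 2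
  exact hy.symm

theorem liftIter_injective {α β : Fin 3 → ℂ}
    (hγ : β 1 * α 0 - α 1 * β 0 ≠ 0 ∨ β 1 * α 2 - α 1 * β 2 ≠ 0) (n : ℕ) :
    Function.Injective (bind₁ (liftIter (liftMap α β) n)) := by
  induction n with
  | zero =>
    intro p q h
    exact (aeval_X_left_apply p).symm.trans (h.trans (aeval_X_left_apply q))
  | succ n ih =>
    intro p q h
    rw [bind₁_liftIter_succ, bind₁_liftIter_succ] at h
    exact liftMap_injective hγ (ih h)

theorem liftIter_ne_zero {α β : Fin 3 → ℂ}
    (hγ : β 1 * α 0 - α 1 * β 0 ≠ 0 ∨ β 1 * α 2 - α 1 * β 2 ≠ 0) (n : ℕ) (j : Fin 4) :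
    liftIter (liftMap α β) n j ≠ 0 := by
  intro h
  refine X_ne_zero (R := ℂ) j (liftIter_injective hγ n ?_)
  rw [bind₁_X_right, h, map_zero]

theorem bind₁_blowDown_recMap (α β : Fin 3 → ℂ) (i : Fin 3) :
    bind₁ blowDown (recMap α β i) = X 3 * bind₁ (liftMap α β) (blowDown i) := by
  fin_cases i <;> simp [recMap, blowDown, liftMap, ← bind₁_blowDown_linForm] <;> ring

theorem bind₁_mul_recMap (α β : Fin 3 → ℂ) (c : MvPolynomial (Fin 4) ℂ)
    (p : Fin 3 → MvPolynomial (Fin 4) ℂ) (i : Fin 3) :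
    bind₁ (fun j => c * p j) (recMap α β i) = c ^ 2 * bind₁ p (recMap α β i) := by
  fin_cases i <;>
    simp [recMap, linForm, Fin.sum_univ_three, algHom_C, algebraMap_eq] <;> ring

/-- The iterates of the lift do lift the iterates of the map. -/
theorem exists_bind₁_blowDown_iter {α β : Fin 3 → ℂ}
    (hγ : β 1 * α 0 - α 1 * β 0 ≠ 0 ∨ β 1 * α 2 - α 1 * β 2 ≠ 0) (n : ℕ) :
    ∃ c ≠ 0, ∀ i, bind₁ blowDown (iter (recMap α β) n i)
      = c * bind₁ (liftIter (liftMap α β) n) (blowDown i) := by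
  induction n with
  | zero =>
    refine ⟨1, one_ne_zero, fun i => ?_⟩
    rw [one_mul]
    exact (bind₁_X_right _ _).trans (aeval_X_left_apply _).symm
  | succ n ih =>
    obtain ⟨c, hc, h⟩ := ih
    -- The square comes from `f` being quadratic, the other factor from pulling back the `t` in `f ∘
    -- π = t · (π ∘ Φ)`.
    refine ⟨c ^ 2 * liftIter (liftMap α β) n 3,
      mul_ne_zero (pow_ne_zero 2 hc) (liftIter_ne_zero hγ n 3), fun i => ?_⟩
    rw [iter, bind₁_bind₁, funext h, bind₁_mul_recMap, ← bind₁_bind₁, bind₁_blowDown_recMap,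
      map_mul, bind₁_X_right, ← bind₁_liftIter_succ]
    ring

/-- The iterates of `Φ` have no common factors that would have to be removed. -/
def IteratesReduced (Φ : Fin 4 → MvPolynomial (Fin 4) ℂ) : Prop :=
  ∀ n, IsRelPrime (liftIter Φ n 0) (liftIter Φ n 1) ∧
    IsRelPrime (liftIter Φ n 2) (liftIter Φ n 3)

theorem bind₁_liftIter_blowDown_one_ne_zero {α β : Fin 3 → ℂ}
    (hγ : β 1 * α 0 - α 1 * β 0 ≠ 0 ∨ β 1 * α 2 - α 1 * β 2 ≠ 0) (n : ℕ) :
    bind₁ (liftIter (liftMap α β) n) (blowDown 1) ≠ 0 := by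
  simpa [blowDown] using liftIter_ne_zero hγ n 2

theorem iter_ne_zero {α β : Fin 3 → ℂ}
    (hγ : β 1 * α 0 - α 1 * β 0 ≠ 0 ∨ β 1 * α 2 - α 1 * β 2 ≠ 0) (n : ℕ) :
    iter (recMap α β) n ≠ 0 := by
  obtain ⟨c, hc, h⟩ := exists_bind₁_blowDown_iter hγ n
  intro h0
  have h1 := h 1
  rw [h0, Pi.zero_apply, map_zero] at h1
  exact mul_ne_zero hc (bind₁_liftIter_blowDown_one_ne_zero hγ n) h1.symm

theorem hasPullbackMatrix_iter {α β : Fin 3 → ℂ}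
    (hγ : β 1 * α 0 - α 1 * β 0 ≠ 0 ∨ β 1 * α 2 - α 1 * β 2 ≠ 0)
    (hred : IteratesReduced (liftMap α β)) (n : ℕ) :
    HasPullbackMatrix (iter (recMap α β) n) (pullbackMatrix ^ n) := by
  obtain ⟨c, hc, h⟩ := exists_bind₁_blowDown_iter hγ n
  refine ⟨liftIter (liftMap α β) n, ⟨iter_ne_zero hγ n,
    ⟨⟨pullbackMatrix ^ n, isWeightedHomogeneous_liftIter α β n⟩, hred n⟩, fun i j => ?_⟩,
    fun p e hp => ⟨?_, isWeightedHomogeneous_bind₁ (isWeightedHomogeneous_liftIter α β n) hp.2⟩⟩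
  · rw [h, h]
    ring
  · exact fun h0 => hp.1 (liftIter_injective hγ n (h0.trans (map_zero _).symm))

theorem hasPullbackMatrix_recMap {α β : Fin 3 → ℂ}
    (hγ : β 1 * α 0 - α 1 * β 0 ≠ 0 ∨ β 1 * α 2 - α 1 * β 2 ≠ 0)
    (hred : IteratesReduced (liftMap α β)) :
    HasPullbackMatrix (recMap α β) pullbackMatrix := by
  have h := hasPullbackMatrix_iter hγ hred 1
  have e : iter (recMap α β) 1 = recMap α β := funext fun i => aeval_X_left_apply _
  rwa [pow_one, e] at h

theorem isWeightedHomogeneous_blowDown (i : Fin 3) :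
    IsWeightedHomogeneous wt (blowDown i) ![1, 0] := by
  have hX := fun i => isWeightedHomogeneous_X ℂ wt i
  have h0 : wt 0 + wt 3 = ![1, 0] := by ext i; fin_cases i <;> simp [wt]
  have h1 : wt 1 + wt 3 = ![1, 0] := by ext i; fin_cases i <;> simp [wt]
  fin_cases i
  · exact h0 ▸ (hX 0).mul (hX 3)
  · exact hX 2
  · exact h1 ▸ (hX 1).mul (hX 3)

theorem hasDegree_iter {α β : Fin 3 → ℂ}
    (hγ : β 1 * α 0 - α 1 * β 0 ≠ 0 ∨ β 1 * α 2 - α 1 * β 2 ≠ 0)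
    (hred : IteratesReduced (liftMap α β)) (n : ℕ) :
    HasDegree (iter (recMap α β) n) (Nat.fib (n + 2)) := by
  obtain ⟨c, hc, h⟩ := exists_bind₁_blowDown_iter hγ n
  have hw := isWeightedHomogeneous_liftIter α β n
  set Ψ := liftIter (liftMap α β) n with hΨ
  have r01 := isRelPrime_bind₁_chart (hw 0) (hw 1) (hred n).1
  have r23 := isRelPrime_bind₁_chart (hw 2) (hw 3) (hred n).2
  refine ⟨iter_ne_zero hγ n, fun i => bind₁ chart (bind₁ Ψ (blowDown i)), fun i => ?_, ?_, ?_⟩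
  · refine isHomogeneous_bind₁_chart
      (isWeightedHomogeneous_bind₁ hw (isWeightedHomogeneous_blowDown i)) ?_
    rw [pullbackMatrix_pow_mulVec]
    rfl
  · intro q hq
    have q0 : q ∣ bind₁ chart (Ψ 3) * bind₁ chart (Ψ 0) := by
      simpa [blowDown, mul_comm] using hq 0
    have q1 : q ∣ bind₁ chart (Ψ 2) := by simpa [blowDown] using hq 1
    have q2 : q ∣ bind₁ chart (Ψ 3) * bind₁ chart (Ψ 1) := by
      simpa [blowDown, mul_comm] using hq 2
    exact r23 q1 (dvd_of_dvd_mul_of_isRelPrime r01 q0 q2)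
  · intro i j
    have key : bind₁ blowDown (iter (recMap α β) n i) * bind₁ Ψ (blowDown j)
        = bind₁ blowDown (iter (recMap α β) n j) * bind₁ Ψ (blowDown i) := by
      rw [h, h]
      ring
    simpa [bind₁_chart_bind₁_blowDown] using congrArg (bind₁ chart) key


/-! ### Reducedness of the iterates when the critical triangle is degenerate -/

theorem dvd_of_dvd_C_mul {σ : Type*} {q p : MvPolynomial σ ℂ} {k : ℂ} (hk : k ≠ 0)
    (h : q ∣ C k * p) : q ∣ p :=
  ((hk.isUnit.map C).dvd_mul_left).1 h

theorem isRelPrime_X {i j : Fin 4} (hij : i ≠ j) :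
    IsRelPrime (X i : MvPolynomial (Fin 4) ℂ) (X j) := by
  rw [((X_prime (R := ℂ) (i := i)).irreducible).isRelPrime_iff_not_dvd, X_dvd_X]
  exact hij

theorem not_dvd_of_isRelPrime {A : Type*} [CommRing A] {x y q : A} (h : IsRelPrime x y)
    (hq : Prime q) (hx : q ∣ x) : ¬ q ∣ y :=
  fun hy => hq.not_isUnit (h hx hy)

theorem not_dvd_of_eval {p q : MvPolynomial (Fin 4) ℂ} (z : Fin 4 → ℂ) (hp : eval z p = 0)
    (hq : eval z q ≠ 0) : ¬ p ∣ q := by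
  intro h
  have := map_dvd (eval z) h
  rw [hp, zero_dvd_iff] at this
  exact hq this

/-- The case `Σ₀ = Σ_γ`. -/
theorem iteratesReduced_of_gam_two_eq_zero {α β : Fin 3 → ℂ}
    (hγ : β 1 * α 0 - α 1 * β 0 ≠ 0) (h0 : β 1 * α 2 - α 1 * β 2 = 0)
    (hβ₁ : β 1 ≠ 0) (hβ₂ : β 2 ≠ 0) : IteratesReduced (liftMap α β) := by
  -- The added third condition says that no curve is mapped to the indeterminacy point `u = b = 0`.
  suffices H : ∀ n, (IsRelPrime (liftIter (liftMap α β) n 0) (liftIter (liftMap α β) n 1) ∧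
      IsRelPrime (liftIter (liftMap α β) n 2) (liftIter (liftMap α β) n 3)) ∧
      IsRelPrime (liftIter (liftMap α β) n 0) (bind₁ (liftIter (liftMap α β) n) (formY β)) from
    fun n => (H n).1
  intro n
  induction n with
  | zero =>
    refine ⟨⟨isRelPrime_X (by decide), isRelPrime_X (by decide)⟩, ?_⟩
    rw [show bind₁ (liftIter (liftMap α β) 0) (formY β) = formY β from aeval_X_left_apply _]
    refine ((X_prime (R := ℂ) (i := (0 : Fin 4))).irreducible).isRelPrime_iff_not_dvd.2 ?_
    exact not_dvd_of_eval ![0, 0, 1, 0] (by simp) (by simpa [formY] using hβ₁)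
  | succ n ih =>
    obtain ⟨⟨ih01, ih23⟩, ih0b⟩ := ih
    have hne := liftIter_ne_zero (α := α) (β := β) (Or.inl hγ) (n + 1)
    rw [bind₁_formY (liftIter (liftMap α β) (n + 1))]
    rw [liftIter_liftMap_succ] at hne ⊢
    have n0 := hne 0
    have n3 := hne 3
    simp only [Matrix.cons_val] at n0 n3 ⊢
    set Ψ := liftIter (liftMap α β) n
    have eb := bind₁_formY Ψ β
    -- `β₁ a - α₁ b = γ₀ u t`, as the `v t` term has coefficient `γ₂ = 0`.
    have ea : C (β 1) * bind₁ Ψ (formY α) = C (α 1) * bind₁ Ψ (formY β)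
        + C (β 1 * α 0 - α 1 * β 0) * (Ψ 0 * Ψ 3) := by
      have h0' := congrArg (C (σ := Fin 4)) h0
      simp only [map_sub, map_mul, map_zero] at h0'
      rw [bind₁_formY, bind₁_formY]
      simp only [map_sub, map_mul]
      linear_combination Ψ 1 * Ψ 3 * h0'
    have b3 : ∀ q, Prime q → q ∣ bind₁ Ψ (formY β) → ¬ q ∣ Ψ 3 := by
      intro q hq hb h3
      refine not_dvd_of_isRelPrime ih23 hq (dvd_of_dvd_C_mul hβ₁ ?_) h3
      have : C (β 1) * Ψ 2 = bind₁ Ψ (formY β) - Ψ 3 * (C (β 0) * Ψ 0 + C (β 2) * Ψ 1) := by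
        rw [eb]
        ring
      rw [this]
      exact dvd_sub hb (h3.mul_right _)
    have b0 : ∀ q, Prime q → q ∣ bind₁ Ψ (formY β) → ¬ q ∣ Ψ 0 := fun q hq hb hq0 =>
      not_dvd_of_isRelPrime ih0b hq hq0 hb
    have ab : ∀ q, Prime q → q ∣ bind₁ Ψ (formY β) → ¬ q ∣ bind₁ Ψ (formY α) := by
      intro q hq hb ha
      have h03 : q ∣ Ψ 0 * Ψ 3 := by
        refine dvd_of_dvd_C_mul hγ ?_
        rw [← sub_eq_iff_eq_add'.2 ea]
        exact dvd_sub (ha.mul_left _) (hb.mul_left _)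
      exact (hq.dvd_or_dvd h03).elim (b0 q hq hb) (b3 q hq hb)
    refine ⟨⟨isRelPrime_of_no_prime_factors (fun h => n0 h.1) ab,
      isRelPrime_of_no_prime_factors (fun h => n3 h.2) fun q hq h1b hq0 => ?_⟩,
      isRelPrime_of_no_prime_factors (fun h => n0 h.1) fun q hq hb h => ?_⟩
    · exact (hq.dvd_or_dvd h1b).elim
        (fun h1 => not_dvd_of_isRelPrime ih01 hq hq0 h1) (fun hb => b0 q hq hb hq0)
    -- Modulo `b`, the composite `b ∘ Φ = β₀ b u + β₁ v b + β₂ a u` is `β₂ a u`.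
    · have ha0 : q ∣ bind₁ Ψ (formY α) * Ψ 0 := by
        refine dvd_of_dvd_C_mul hβ₂ ?_
        refine (dvd_add_right (hb.mul_left (C (β 0) * Ψ 0 + C (β 1) * Ψ 1))).1 ?_
        convert h using 1
        ring
      exact (hq.dvd_or_dvd ha0).elim (ab q hq hb) (b0 q hq hb)

/-- The factor of `β · x` other than `t` when `β₁ = 0`. -/
def residualForm (β : Fin 3 → ℂ) : MvPolynomial (Fin 4) ℂ := C (β 2) * X 1 + C (β 0) * X 0

theorem irreducible_residualForm {β : Fin 3 → ℂ} (hβ₂ : β 2 ≠ 0) :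
    Irreducible (residualForm β) := by
  refine irreducible_mul_X_add _ _ 1 (by simpa using hβ₂) (by simp) ?_
    ((hβ₂.isUnit.map C).isRelPrime_left)
  rcases eq_or_ne (β 0) 0 with h | h
  · simp [h]
  · rw [C_mul_X_eq_monomial, vars_monomial_single 0 one_ne_zero h]
    decide

theorem formY_eq_mul_residualForm {β : Fin 3 → ℂ} (hβ₁ : β 1 = 0) :
    formY β = X 3 * residualForm β := by
  rw [formY, hβ₁, residualForm, map_zero]
  ring

theorem liftMap_not_dvd {α β : Fin 3 → ℂ} (hβ₂ : β 2 ≠ 0) (hα₁ : α 1 ≠ 0)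
    {q : MvPolynomial (Fin 4) ℂ} (hq : Prime q) (h : q ∣ X 3 ∨ q ∣ residualForm β) :
    ¬ q ∣ formY α ∧ ¬ q ∣ X 0 := by
  rcases h with h | h
  · refine ⟨fun ha => ?_, not_dvd_of_isRelPrime (isRelPrime_X (by decide)) hq h⟩
    have h2 : q ∣ C (α 1) * X 2 := by
      have : C (α 1) * X 2 = formY α - X 3 * (C (α 0) * X 0 + C (α 2) * X 1) := by
        rw [formY]
        ring
      rw [this]
      exact dvd_sub ha (h.mul_right _)
    exact not_dvd_of_isRelPrime (isRelPrime_X (by decide)) hq h (dvd_of_dvd_C_mul hα₁ h2)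
  · refine ⟨fun ha => ?_, fun h0 => ?_⟩
    · have hla : residualForm β ∣ formY α :=
        ((hq.irreducible.associated_of_dvd (irreducible_residualForm hβ₂) h).symm.dvd).trans ha
      -- The point where `l = 0` meets `E₁`; there `a = α₁`.
      refine not_dvd_of_eval ![β 2, -β 0, 1, 0] ?_ ?_ hla
      · simp [residualForm]
        ring
      · simpa [formY] using hα₁
    · have h1 : q ∣ C (β 2) * X 1 := (dvd_add_left (h0.mul_left (C (β 0)))).1 h
      exact not_dvd_of_isRelPrime (isRelPrime_X (by decide)) hq h0 (dvd_of_dvd_C_mul hβ₂ h1)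

/-- When `β₁ = 0`, the iterates contract the components of `{β · x = 0}` alternately to
`[0 : 0 : 1]` and to a point of `E₁`. -/
theorem liftIter_dvd_or_dvd {α β : Fin 3 → ℂ} (hβ₁ : β 1 = 0) (hβ₂ : β 2 ≠ 0) (hα₁ : α 1 ≠ 0)
    {q : MvPolynomial (Fin 4) ℂ} (hq : Prime q) (hql : q ∣ X 3 ∨ q ∣ residualForm β) (n : ℕ) :
    (q ∣ liftIter (liftMap α β) (n + 1) 0 ∧ q ∣ liftIter (liftMap α β) (n + 1) 2 ∧
      ¬ q ∣ liftIter (liftMap α β) (n + 1) 1 ∧ ¬ q ∣ liftIter (liftMap α β) (n + 1) 3) ∨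
    (q ∣ liftIter (liftMap α β) (n + 1) 3 ∧ ¬ q ∣ liftIter (liftMap α β) (n + 1) 0 ∧
      ¬ q ∣ liftIter (liftMap α β) (n + 1) 2) := by
  induction n with
  | zero =>
    obtain ⟨h2, h3⟩ := liftMap_not_dvd hβ₂ hα₁ hq hql
    have h1 : q ∣ formY β := by
      rw [formY_eq_mul_residualForm hβ₁]
      exact hql.elim (fun h => h.mul_right _) (fun h => h.mul_left _)
    rw [zero_add, liftIter_one]
    exact Or.inl ⟨h1, h1.mul_left _, h2, h3⟩
  | succ n ih =>
    rw [liftIter_liftMap_succ α β (n + 1)]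
    generalize liftIter (liftMap α β) (n + 1) = Ψ at ih
    have eb : bind₁ Ψ (formY β) = Ψ 3 * (C (β 0) * Ψ 0 + C (β 2) * Ψ 1) := by
      rw [bind₁_formY, hβ₁, map_zero]
      ring
    have ea : bind₁ Ψ (formY α)
        = C (α 1) * Ψ 2 + (C (α 0) * (Ψ 0 * Ψ 3) + C (α 2) * (Ψ 1 * Ψ 3)) := by
      rw [bind₁_formY]
      ring
    simp only [Matrix.cons_val]
    rcases ih with ⟨h0, h2, h1, h3⟩ | ⟨h3, h0, h2⟩
    · have hnb : ¬ q ∣ bind₁ Ψ (formY β) := by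
        rw [eb]
        refine hq.not_dvd_mul h3 fun h => h1 (dvd_of_dvd_C_mul hβ₂ ?_)
        exact (dvd_add_right (h0.mul_left _)).1 h
      exact Or.inr ⟨h0, hnb, hq.not_dvd_mul h1 hnb⟩
    · have hqb : q ∣ bind₁ Ψ (formY β) := eb ▸ h3.mul_right _
      refine Or.inl ⟨hqb, hqb.mul_left _, fun h => h2 (dvd_of_dvd_C_mul hα₁ ?_), h0⟩
      rw [ea] at h
      exact (dvd_add_left (dvd_add ((h3.mul_left _).mul_left _)
        ((h3.mul_left _).mul_left _))).1 h

/-- When `β₁ = 0`, the lift of `f_{α,β}` is invertible away from `{t = 0}` and the other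
component of `{β · x = 0}`. -/
theorem exists_pow_mul_eq_bind₁_liftMap {α β : Fin 3 → ℂ} (hβ₁ : β 1 = 0) (hα₁ : α 1 ≠ 0) :
    ∃ K, bind₁ (liftMap α β) K = X 3 * residualForm β * (X 3 * residualForm β * residualForm β) ∧
      ∀ r, ∃ (N : ℕ) (s : MvPolynomial (Fin 4) ℂ),
        bind₁ (liftMap α β) K ^ N * r = bind₁ (liftMap α β) s := by
  have hb := formY_eq_mul_residualForm hβ₁
  have φ0 : bind₁ (liftMap α β) (X 0) = X 3 * residualForm β := by rw [bind₁_X_right, ← hb]; rfl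
  have φ1 : bind₁ (liftMap α β) (X 1) = formY α := by rw [bind₁_X_right]; rfl
  have φ2 : bind₁ (liftMap α β) (X 2) = X 1 * (X 3 * residualForm β) := by
    rw [bind₁_X_right, ← hb]
    rfl
  have φ3 : bind₁ (liftMap α β) (X 3) = X 0 := by rw [bind₁_X_right]; rfl
  have φC : ∀ k, bind₁ (liftMap α β) (C k) = C k := fun k => bind₁_C_right _ _
  generalize bind₁ (liftMap α β) = φ at *
  have φD : φ (C (β 0) * (X 3 * X 0) + C (β 2) * X 2)
      = X 3 * residualForm β * residualForm β := by
    rw [map_add, map_mul, map_mul, map_mul, φ0, φ2, φ3, φC, φC]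
    conv_rhs => rw [mul_assoc]; enter [2, 1]; rw [residualForm]
    ring
  obtain ⟨D, φD⟩ : ∃ D, φ D = X 3 * residualForm β * residualForm β := ⟨_, φD⟩
  generalize residualForm β = l at *
  have φK : φ (X 0 * D) = X 3 * l * (X 3 * l * l) := by rw [map_mul, φ0, φD]
  -- It suffices to invert on coordinates. With `φ K = t² l³`: `u = φ t`, `φK · v = φ (w D)`, `φK ·
  -- t = φ (u³)`, and `w` is solved from `φK · a = φ (K v)` using `α₁ ≠ 0`.
  refine ⟨X 0 * D, φK, exists_pow_mul_mem_range _ _ ?_⟩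
  rw [φK, Fin.forall_fin_succ, Fin.forall_fin_succ, Fin.forall_fin_succ, Fin.forall_fin_one]
  refine ⟨⟨0, X 3, ?_⟩, ⟨1, X 2 * D, ?_⟩,
    ⟨1, C (α 1)⁻¹ * (X 0 * D * X 1 - C (α 0) * (X 3 * X 0 ^ 3) - C (α 2) * (X 2 * X 0 ^ 2)), ?_⟩,
    ⟨1, X 0 ^ 3, ?_⟩⟩
  · rw [φ3, pow_zero, one_mul]
  · rw [pow_one, map_mul, φ2, φD]
    change _ * (X 1 : MvPolynomial (Fin 4) ℂ) = _
    ring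
  · have hinv : C (α 1)⁻¹ * C (α 1) = (1 : MvPolynomial (Fin 4) ℂ) := by
      rw [← C_mul, inv_mul_cancel₀ hα₁, C_1]
    simp only [map_mul, map_sub, map_pow, φD, φ0, φ1, φ2, φ3, φC, formY, pow_one]
    change _ * (X 2 : MvPolynomial (Fin 4) ℂ) = _
    linear_combination -(X 3 * l * (X 3 * l * l)) * X 2 * hinv
  · rw [pow_one, map_pow, φ0]
    change _ * (X 3 : MvPolynomial (Fin 4) ℂ) = _
    ring

/-- The case `Σ_β = Σ_γ`. -/
theorem iteratesReduced_of_beta_one_eq_zero {α β : Fin 3 → ℂ}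
    (hβ₁ : β 1 = 0) (hβ₂ : β 2 ≠ 0) (hα₁ : α 1 ≠ 0) : IteratesReduced (liftMap α β) := by
  have hγ : β 1 * α 0 - α 1 * β 0 ≠ 0 ∨ β 1 * α 2 - α 1 * β 2 ≠ 0 :=
    Or.inr (by simpa [hβ₁] using ⟨hα₁, hβ₂⟩)
  obtain ⟨K, φK, hK⟩ := exists_pow_mul_eq_bind₁_liftMap (α := α) hβ₁ hα₁
  have key : ∀ n i j, IsRelPrime (liftIter (liftMap α β) n i) (liftIter (liftMap α β) n j) →
      ∀ q, Prime q → q ∣ liftIter (liftMap α β) (n + 1) i →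
        q ∣ liftIter (liftMap α β) (n + 1) j → q ∣ X 3 ∨ q ∣ residualForm β := by
    intro n i j hij q hq hi hj
    rw [liftIter_succ'] at hi hj
    have h : q ∣ bind₁ (liftMap α β) K :=
      prime_dvd_of_dvd_map_of_dvd_map (bind₁ (liftMap α β)).toRingHom (liftMap_injective hγ) K hK
        hij hq hi hj
    rw [φK] at h
    simp only [hq.dvd_mul] at h
    tauto
  intro n
  induction n with
  | zero => exact ⟨isRelPrime_X (by decide), isRelPrime_X (by decide)⟩
  | succ n ih =>
    have hne := liftIter_ne_zero hγ (n + 1)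
    refine ⟨isRelPrime_of_no_prime_factors (fun h => hne 0 h.1) fun q hq h0 h1 => ?_,
      isRelPrime_of_no_prime_factors (fun h => hne 2 h.1) fun q hq h2 h3 => ?_⟩
    · rcases liftIter_dvd_or_dvd hβ₁ hβ₂ hα₁ hq (key n 0 1 ih.1 q hq h0 h1) n with h' | h'
      · exact h'.2.2.1 h1
      · exact h'.2.1 h0
    · rcases liftIter_dvd_or_dvd hβ₁ hβ₂ hα₁ hq (key n 2 3 ih.2 q hq h2 h3) n with h' | h'
      · exact h'.2.2.2 h3
      · exact h'.2.2 h2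

theorem iteratesReduced_of_degenerate {α β : Fin 3 → ℂ} (hαβ : ∀ c : ℂ, α ≠ c • β)
    (h₁ : (α 1, β 1) ≠ (0, 0)) (h₂ : (α 2, β 2) ≠ (0, 0)) (h₃ : (β 1, β 2) ≠ (0, 0))
    (h : β 1 = 0 ∨ β 1 * α 2 - α 1 * β 2 = 0) : IteratesReduced (liftMap α β) := by
  rcases eq_or_ne (β 1) 0 with hb | hb
  · refine iteratesReduced_of_beta_one_eq_zero hb (fun h' => h₃ ?_) (fun h' => h₁ ?_) <;>
      simp [hb, h']
  · have h0 := h.resolve_left hb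
    refine iteratesReduced_of_gam_two_eq_zero
      ((gam_ne_zero hαβ h₁ h₃).resolve_right (by simp [h0])) h0 hb fun h' => h₂ ?_
    have : α 2 = 0 := by simpa [h', hb] using h0
    simp [h', this]

end LinFracRec

end

theorem proposition2p2 (α β : Fin 3 → ℂ)
    (hαβ : ∀ c : ℂ, α ≠ c • β)
    (h₁ : (α 1, β 1) ≠ (0, 0)) (h₂ : (α 2, β 2) ≠ (0, 0)) (h₃ : (β 1, β 2) ≠ (0, 0)) :
    (LinFracRec.CriticalTriangleDegenerate α β ↔ β 1 = 0 ∨ β 1 * α 2 - α 1 * β 2 = 0) ∧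
    (LinFracRec.CriticalTriangleDegenerate α β →
      LinFracRec.HasDynamicalDegree (LinFracRec.recMap α β) Real.goldenRatio ∧
      LinFracRec.LiftIsOneRegular (LinFracRec.recMap α β) ∧
      LinFracRec.HasPullbackMatrix (LinFracRec.recMap α β) !![2, 1; -1, -1] ∧
      spectralRadius ℂ ((!![2, 1; -1, -1] : Matrix (Fin 2) (Fin 2) ℤ).map (Int.cast : ℤ → ℂ))
        = ENNReal.ofReal Real.goldenRatio) := by
  have hiff := LinFracRec.criticalTriangleDegenerate_iff hαβ h₁ h₃
  refine ⟨hiff, fun hdeg => ?_⟩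
  have hγ := LinFracRec.gam_ne_zero hαβ h₁ h₃
  have hred := LinFracRec.iteratesReduced_of_degenerate hαβ h₁ h₂ h₃ (hiff.1 hdeg)
  have hpull := LinFracRec.hasPullbackMatrix_recMap hγ hred
  exact ⟨⟨fun k => Nat.fib (k + 2), LinFracRec.hasDegree_iter hγ hred,
      LinFracRec.tendsto_fib_rpow⟩,
    ⟨LinFracRec.pullbackMatrix, hpull, LinFracRec.hasPullbackMatrix_iter hγ hred⟩,
    hpull, LinFracRec.spectralRadius_pullbackMatrix⟩
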